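/- For $\nu\in\mathbb C$ and $x>0$ let $$\mathbf H_\nu(x)=\sum_{n=0}^{\infty}\frac{(-1)^n\,(x/2)^{2n+\nu+1}}{\Gamma(n+\frac32)\,\Gamma(n+\nu+\frac32)}$$ be the Struve function of order $\nu$. Let $a>0$ and let $\mu,\nu\in\mathbb C$ satisfy $$\operatorname{Re}\nu>-\tfrac32,\qquad -\tfrac52<\operatorname{Re}(\mu+\nu)<-\tfrac12,\qquad \operatorname{Re}\mu<0 .$$ Then $u\mapsto u^{\mu+1/2}\,\mathbf H_\nu(au)$ is Lebesgue integrable on $(0,R]$ for every $R>0$, the improper integral $\int_0^\infty=\lim_{R\to\infty}\int_0^R$ below converges, and $$\int_0^\infty u^{\mu+\frac12}\,\mathbf H_\nu(au)\,du=\frac{2^{\mu+\frac12}\,\Gamma\!\left(\frac\mu2+\frac\nu2+\frac34\right)}{a^{\mu+\frac32}\,\Gamma\!\left(\frac\nu2-\frac\mu2+\frac14\right)}\,\tan\!\left[\pi\left(\tfrac\mu2+\tfrac\nu2+\tfrac34\right)\right].$$ Here $1/\Gamma$ is taken to be $0$ at the poles of $\Gamma$. If $\mu+\nu=-\frac32$,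 where the factor $\Gamma(z)\tan(\pi z)$, $z=\frac\mu2+\frac\nu2+\frac34$, has a removable singularity ($z=0$), the right-hand side is understood as its limit, that is, with $\Gamma(z)\tan(\pi z)$ replaced by $\pi$. -/

import Mathlib

/-- The Struve function `𝐇_ν(z) = ∑ₙ (-1)ⁿ (z/2)^(2n+ν+1) / (Γ(n+3/2) Γ(n+ν+3/2))` of complex order
`ν`, with the principal branch of `(z/2)^(ν+1)`. A term with `n + ν + 3/2` a pole of `Γ` is `0`
(as it should be, `1/Γ` being `0` there), because `Complex.Gamma` has the value `0` at its poles. -/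
noncomputable def struveH (ν z : ℂ) : ℂ :=
  (z / 2) ^ (ν + 1) *
    ∑' n : ℕ, (-1) ^ n * (z / 2) ^ (2 * n) /
      (Complex.Gamma (n + 3 / 2) * Complex.Gamma (n + ν + 3 / 2))

/-- The integrand `u^(μ+1/2) 𝐇_ν(a u)`, as a function of the real variable `u`. -/
noncomputable def struveIntegrand (μ ν : ℂ) (a u : ℝ) : ℂ :=
  (u : ℂ) ^ (μ + 1 / 2) * struveH ν ((a : ℂ) * (u : ℂ))

/-- The improper integral `∫₀^∞ f(u) du` converges, with value `I`: `f` is Lebesgue integrable on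
every `(0, R]`, and `∫₀^R f(u) du` tends to `I` as `R → ∞`. -/
def HasImproperIntegral (f : ℝ → ℂ) (I : ℂ) : Prop :=
  (∀ R : ℝ, 0 < R → MeasureTheory.IntegrableOn f (Set.Ioc 0 R)) ∧
    Filter.Tendsto (fun R : ℝ => ∫ u in (0 : ℝ)..R, f u) Filter.atTop (nhds I)

/-!
Write `𝐇_ν(x) = (x/2)^(ν+1) T_ν(x)`, where `T_ν` is entire and even, and put `p = μ + ν + 3/2`. After
the substitution `a u ↦ u` the integral becomes a multiple of `∫₀^∞ u^p T_ν(u) du` with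
`-1 < Re p < 1`, whose value is
`2^p π / (Γ(1-p/2) cos(πp/2) Γ(ν+1-p/2))` (`struveMellin`). By the reflection formula this is the
asserted right-hand side, and it is regular at `p = 0`, so that the removable singularity needs no
separate analysis.

If `Re ν > 1/2`, expanding the cosine and integrating termwise gives
`x² T_ν(x) = 4 / (√π Γ(ν-1/2)) ∫₀¹ (1-r)^(ν-3/2) (1 - cos(x√r)) dr`. Since `1 - cos u` is
`O(min(1, u²))`, Fubini applies for every `p` in the strip
(`integrableOn_and_integral_struveT`), and the value is a Beta integral times the Mellin transform
of `1 - cos` (`mellin_one_sub_cos`). The latter comes from two applications of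
`mellin_laplace`, the formula for the Mellin transform of a Laplace transform: one to `exp (-y)`,
which gives the Mellin transform of `1/(1+x)`, and one to `1 - cos y`, whose Laplace transform is
`1/(x(1+x²))`.

For smaller `ν` the integral converges only conditionally. Integration by parts with
`(x^(ν+1) 𝐇_{ν+1})' = x^(ν+1) 𝐇_ν` (`integral_cpow_mul_struveT`) keeps `p` fixed, raises the order
by one, and matches the functional equation of `Γ` in the value (`struveMellin_succ`), so two steps
suffice. The boundary term at infinity vanishes because `𝐇_κ(x)` is `O(x^(Re κ - 1))` for
`Re κ > 1/2`, by the integral representation, and `O(x^(-1/2))` for `-1/2 < Re κ ≤ 1/2`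
(`exists_norm_struveT_le_of_re_le`). The second bound follows from Struve's differential equation:
`√x 𝐇_κ(x)` minus a multiple of `x^(κ-1/2)` is an oscillator with a perturbation of size `x⁻²`, and
an energy estimate bounds it.
-/

open Filter Topology Set MeasureTheory

/-! ### The power series of the Struve function -/

/-- The `n`-th coefficient `(-1)ⁿ / (Γ(n+3/2) Γ(n+ν+3/2))` of the Struve series. -/
noncomputable def struveCoeff (ν : ℂ) (n : ℕ) : ℂ :=
  (-1) ^ n / (Complex.Gamma (n + 3 / 2) * Complex.Gamma (n + ν + 3 / 2))

/-- The function `T_ν(x) = ∑ₙ (-1)ⁿ (x/2)^(2n) / (Γ(n+3/2) Γ(n+ν+3/2))` of a real variable, so that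
`𝐇_ν(x) = (x/2)^(ν+1) T_ν(x)` for `x > 0`. -/
noncomputable def struveT (ν : ℂ) (x : ℝ) : ℂ :=
  ∑' n : ℕ, struveCoeff ν n * (((x : ℂ) / 2) ^ 2) ^ n

theorem struveH_eq_struveT (ν : ℂ) (x : ℝ) :
    struveH ν x = ((x : ℂ) / 2) ^ (ν + 1) * struveT ν x := by
  unfold struveH struveT struveCoeff
  congr 1
  refine tsum_congr fun n => ?_
  rw [← pow_mul]
  ring

theorem gamma_natCast_add_ne_zero {s : ℂ} (hs : 0 < s.re) (n : ℕ) :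
    Complex.Gamma (n + s) ≠ 0 :=
  Complex.Gamma_ne_zero_of_re_pos (by
    rw [Complex.add_re, Complex.natCast_re]; positivity)

theorem struveCoeff_ne_zero {ν : ℂ} (hν : -(3 / 2) < ν.re) (n : ℕ) : struveCoeff ν n ≠ 0 := by
  have h1 := gamma_natCast_add_ne_zero (s := 3 / 2) (by norm_num) n
  have h2 := gamma_natCast_add_ne_zero (s := ν + 3 / 2) (by norm_num; linarith) n
  rw [← add_assoc] at h2
  exact div_ne_zero (by simp) (mul_ne_zero h1 h2)

theorem natCast_add_ne_zero {s : ℂ} (hs : 0 < s.re) (n : ℕ) : (n : ℂ) + s ≠ 0 := by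
  intro h
  have := congrArg Complex.re h
  rw [Complex.add_re, Complex.natCast_re, Complex.zero_re] at this
  have : (0 : ℝ) ≤ n := by positivity
  linarith

theorem struveCoeff_succ_mul {ν : ℂ} (hν : -(3 / 2) < ν.re) (n : ℕ) :
    struveCoeff ν (n + 1) * ((n + 3 / 2) * (n + (ν + 3 / 2))) = -struveCoeff ν n := by
  have a1 := natCast_add_ne_zero (s := 3 / 2) (by norm_num) n
  have a2 := natCast_add_ne_zero (s := ν + 3 / 2) (by norm_num; linarith) n
  have g1 := gamma_natCast_add_ne_zero (s := 3 / 2) (by norm_num) n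
  have g2 := gamma_natCast_add_ne_zero (s := ν + 3 / 2) (by norm_num; linarith) n
  have e1 := Complex.Gamma_add_one _ a1
  have e2 := Complex.Gamma_add_one _ a2
  unfold struveCoeff
  rw [show ((n + 1 : ℕ) : ℂ) + 3 / 2 = (n + 3 / 2) + 1 by push_cast; ring,
    show ((n + 1 : ℕ) : ℂ) + ν + 3 / 2 = (n + (ν + 3 / 2)) + 1 by push_cast; ring, e1, e2,
    show (n : ℂ) + ν + 3 / 2 = n + (ν + 3 / 2) by ring, pow_succ]
  generalize Complex.Gamma (n + 3 / 2) = G1 at g1 ⊢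
  generalize Complex.Gamma (n + (ν + 3 / 2)) = G2 at g2 ⊢
  generalize (n : ℂ) + 3 / 2 = b1 at a1 ⊢
  generalize (n : ℂ) + (ν + 3 / 2) = b2 at a2 ⊢
  field_simp

theorem struveCoeff_sub_one {ν : ℂ} (hν : -(1 / 2) < ν.re) (n : ℕ) :
    struveCoeff (ν - 1) n = (n + (ν + 1 / 2)) * struveCoeff ν n := by
  have a2 := natCast_add_ne_zero (s := ν + 1 / 2) (by norm_num; linarith) n
  have e2 := Complex.Gamma_add_one _ a2
  have g2 := gamma_natCast_add_ne_zero (s := ν + 1 / 2) (by norm_num; linarith) n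
  have g1 := gamma_natCast_add_ne_zero (s := 3 / 2) (by norm_num) n
  unfold struveCoeff
  rw [show (n : ℂ) + ν + 3 / 2 = (n + (ν + 1 / 2)) + 1 by ring, e2,
    show (n : ℂ) + (ν - 1) + 3 / 2 = n + (ν + 1 / 2) by ring]
  generalize Complex.Gamma (n + (ν + 1 / 2)) = G2 at g2 ⊢
  generalize (n : ℂ) + (ν + 1 / 2) = b2 at a2 ⊢
  field_simp

theorem summable_norm_struveCoeff {ν : ℂ} (hν : -(3 / 2) < ν.re) (r : ℝ) :
    Summable fun n => ‖struveCoeff ν n‖ * r ^ n := by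
  rcases eq_or_ne r 0 with rfl | hr
  · exact summable_of_ne_finset_zero (s := {0}) (fun n hn => by
      rw [zero_pow (by simpa using hn), mul_zero])
  refine summable_of_ratio_test_tendsto_lt_one (l := 0) zero_lt_one
    (Eventually.of_forall fun n => mul_ne_zero (norm_ne_zero_iff.2 (struveCoeff_ne_zero hν n))
      (pow_ne_zero _ hr)) ?_
  have hA : ∀ n : ℕ, ‖‖struveCoeff ν (n + 1)‖ * r ^ (n + 1)‖ / ‖‖struveCoeff ν n‖ * r ^ n‖ =
      |r| / (‖(n : ℂ) + 3 / 2‖ * ‖(n : ℂ) + (ν + 3 / 2)‖) := by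
    intro n
    have h := congrArg norm (struveCoeff_succ_mul hν n)
    rw [norm_neg, norm_mul, norm_mul] at h
    have c0 := norm_ne_zero_iff.2 (struveCoeff_ne_zero hν (n + 1))
    have a1 := norm_ne_zero_iff.2 (natCast_add_ne_zero (s := 3 / 2) (by norm_num) n)
    have a2 := norm_ne_zero_iff.2 (natCast_add_ne_zero (s := ν + 3 / 2) (by norm_num; linarith) n)
    have hr' : |r| ≠ 0 := abs_ne_zero.2 hr
    rw [← h]
    simp only [norm_mul, norm_pow, Real.norm_eq_abs, pow_succ, abs_norm]
    generalize ‖(n : ℂ) + 3 / 2‖ = b1 at a1 ⊢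
    generalize ‖(n : ℂ) + (ν + 3 / 2)‖ = b2 at a2 ⊢
    field_simp
  simp_rw [hA]
  have hB : ∀ s : ℂ, Tendsto (fun n : ℕ => ‖(n : ℂ) + s‖) atTop atTop := fun s =>
    tendsto_atTop_mono (fun n => by simpa using norm_sub_le_norm_add (n : ℂ) s)
      (tendsto_atTop_add_const_right _ (-‖s‖) tendsto_natCast_atTop_atTop)
  exact ((hB _).atTop_mul_atTop₀ (hB _)).const_div_atTop _

/-- Termwise differentiation of an everywhere convergent power series. -/
theorem hasDerivAt_tsum_mul_pow {c : ℕ → ℂ} (hc : ∀ r : ℝ, Summable fun n => ‖c n‖ * r ^ n)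
    (w : ℂ) :
    HasDerivAt (fun z => ∑' n, c n * z ^ n) (∑' n, c n * (n * w ^ (n - 1))) w := by
  set R : ℝ := ‖w‖ + 1
  have hR : 1 ≤ R := by simp [R]
  refine hasDerivAt_tsum_of_isPreconnected (hc (2 * R)) (t := Metric.ball 0 R)
    (y₀ := 0) Metric.isOpen_ball (convex_ball 0 R).isPreconnected
    (fun n z _ => (hasDerivAt_pow n z).const_mul (c n)) (fun n z hz => ?_)
    (Metric.mem_ball_self (by linarith)) ?_ (by simp [R])
  · rw [norm_mul, norm_mul, norm_pow, Complex.norm_natCast, mul_pow]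
    have hz' : ‖z‖ ≤ R := by simpa using (Metric.mem_ball.1 hz).le
    have h1 : ‖z‖ ^ (n - 1) ≤ R ^ n :=
      (pow_le_pow_left₀ (norm_nonneg _) hz' _).trans (pow_le_pow_right₀ hR (Nat.sub_le _ _))
    have h2 : (n : ℝ) ≤ 2 ^ n := by exact_mod_cast Nat.lt_two_pow_self.le
    gcongr
  · exact summable_of_ne_finset_zero (s := {0}) (fun n hn => by
      rw [zero_pow (by simpa using hn), mul_zero])

theorem summable_mul_pow {c : ℕ → ℂ} (hc : ∀ r : ℝ, Summable fun n => ‖c n‖ * r ^ n) (w : ℂ) :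
    Summable fun n => c n * w ^ n :=
  Summable.of_norm (by simpa using hc ‖w‖)

theorem summable_natCast_mul_pow {c : ℕ → ℂ} (hc : ∀ r : ℝ, Summable fun n => ‖c n‖ * r ^ n)
    (w : ℂ) : Summable fun n => n * c n * w ^ n := by
  refine Summable.of_norm_bounded (hc (2 * ‖w‖)) fun n => ?_
  rw [norm_mul, norm_mul, norm_pow, Complex.norm_natCast, mul_pow]
  have h2 : (n : ℝ) ≤ 2 ^ n := by exact_mod_cast Nat.lt_two_pow_self.le
  calc (n : ℝ) * ‖c n‖ * ‖w‖ ^ n ≤ 2 ^ n * ‖c n‖ * ‖w‖ ^ n := by gcongr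
    _ = _ := by ring

theorem continuous_struveT {ν : ℂ} (hν : -(3 / 2) < ν.re) : Continuous (struveT ν) := by
  have h : Continuous fun z : ℂ => ∑' n, struveCoeff ν n * z ^ n :=
    continuous_iff_continuousAt.2 fun w =>
      (hasDerivAt_tsum_mul_pow (summable_norm_struveCoeff hν) w).continuousAt
  exact h.comp (g := fun z : ℂ => ∑' n, struveCoeff ν n * z ^ n)
    (f := fun x : ℝ => ((x : ℂ) / 2) ^ 2) (by fun_prop)

theorem hasDerivAt_struveT_tsum {ν : ℂ} (hν : -(3 / 2) < ν.re) {x : ℝ} (hx : x ≠ 0) :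
    HasDerivAt (struveT ν)
      (2 * (∑' n : ℕ, n * struveCoeff ν n * (((x : ℂ) / 2) ^ 2) ^ n) / x) x := by
  have hx' : (x : ℂ) ≠ 0 := by exact_mod_cast hx
  have h0 : HasDerivAt (fun y : ℝ => ((y : ℂ) / 2) ^ 2) ((x : ℂ) / 2) x := by
    have h := ((Complex.ofRealCLM.hasDerivAt (x := x)).div_const 2).pow 2
    convert! h using 1
    simp
    ring
  have h := (hasDerivAt_tsum_mul_pow (summable_norm_struveCoeff hν) (((x : ℂ) / 2) ^ 2)).comp x h0
  convert! h using 1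
  rw [← tsum_mul_left, ← tsum_div_const, ← tsum_mul_right]
  refine tsum_congr fun n => ?_
  rcases n with _ | n
  · simp
  · rw [Nat.add_sub_cancel, pow_succ]
    field_simp

/-- The contiguity relation equivalent to `(x^ν 𝐇_ν)' = x^ν 𝐇_{ν-1}`. -/
theorem hasDerivAt_struveT {ν : ℂ} (hν : -(1 / 2) < ν.re) {x : ℝ} (hx : x ≠ 0) :
    HasDerivAt (struveT ν)
      ((2 * struveT (ν - 1) x - (2 * ν + 1) * struveT ν x) / x) x := by
  have hν' : -(3 / 2) < ν.re := by linarith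
  convert! hasDerivAt_struveT_tsum hν' hx using 1
  congr 1
  set w : ℂ := ((x : ℂ) / 2) ^ 2 with hw
  have h : struveT (ν - 1) x = (∑' n : ℕ, n * struveCoeff ν n * w ^ n) +
      (ν + 1 / 2) * struveT ν x := by
    unfold struveT
    rw [← tsum_mul_left, ← Summable.tsum_add
      (summable_natCast_mul_pow (summable_norm_struveCoeff hν') w)
      ((summable_mul_pow (summable_norm_struveCoeff hν') w).mul_left _)]
    refine tsum_congr fun n => ?_
    rw [struveCoeff_sub_one hν]
    ring
  rw [h]
  ring

/-- The contiguity relation equivalent to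
`(x^(1-ν) 𝐇_{ν-1})' = const - x^(1-ν) 𝐇_ν`. -/
theorem hasDerivAt_struveT_sub_one {ν : ℂ} (hν : -(1 / 2) < ν.re) {x : ℝ} (hx : x ≠ 0) :
    HasDerivAt (struveT (ν - 1))
      ((struveCoeff (ν - 1) 0 - (x : ℂ) ^ 2 / 2 * struveT ν x - struveT (ν - 1) x) / x) x := by
  have hν' : -(3 / 2) < ν.re := by linarith
  have hν1 : -(3 / 2) < (ν - 1).re := by simp; linarith
  convert! hasDerivAt_struveT_tsum hν1 hx using 1
  congr 1
  set w : ℂ := ((x : ℂ) / 2) ^ 2 with hw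
  have hs := summable_mul_pow (summable_norm_struveCoeff hν1) w
  have hsn := summable_natCast_mul_pow (summable_norm_struveCoeff hν1) w
  have h : (∑' n : ℕ, n * struveCoeff (ν - 1) n * w ^ n) + 1 / 2 * struveT (ν - 1) x =
      1 / 2 * struveCoeff (ν - 1) 0 - w * struveT ν x := by
    unfold struveT
    rw [← tsum_mul_left, ← tsum_mul_left, ← Summable.tsum_add hsn (hs.mul_left _),
      (hsn.add (hs.mul_left _)).tsum_eq_zero_add, sub_eq_add_neg _ (∑' _, _),
      ← tsum_neg]
    congr 1
    · simp
    · refine tsum_congr fun n => ?_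
      have h1 := struveCoeff_sub_one hν (n + 1)
      have h2 := struveCoeff_succ_mul hν' n
      push_cast at h1 ⊢
      rw [h1, pow_succ]
      linear_combination w ^ n * w * h2
  rw [show (x : ℂ) ^ 2 / 2 = 2 * w by rw [hw]; ring]
  linear_combination (-2 : ℂ) * h

/-! ### Growth of the Struve function of small order -/

/-- If `v'' = -v + O(x⁻² (|v| + 1))` on `[1, ∞)`, then `v` is bounded there: with the
shifted energy `E = 1 + |v|² + |v'|²`, the function `E exp (2 K / x)` is decreasing. -/
theorem exists_norm_le_of_perturbed_oscillator {v v' v'' : ℝ → ℂ} {K : ℝ}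
    (h1 : ∀ x, 0 < x → HasDerivAt v (v' x) x) (h2 : ∀ x, 0 < x → HasDerivAt v' (v'' x) x)
    (hK : ∀ x, 1 ≤ x → ‖v x + v'' x‖ ≤ K * (‖v x‖ + 1) / x ^ 2) :
    ∃ C, ∀ x, 1 ≤ x → ‖v x‖ ≤ C := by
  have hK0 : 0 ≤ K := by
    have := (norm_nonneg _).trans (hK 1 le_rfl)
    simp only [one_pow, div_one] at this
    exact nonneg_of_mul_nonneg_left this (by positivity)
  set E : ℝ → ℝ := fun x => 1 + (‖v x‖ ^ 2 + ‖v' x‖ ^ 2) with hE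
  have hE' : ∀ x, 0 < x → HasDerivAt E (2 * inner ℝ (v' x) (v x + v'' x)) x := by
    intro x hx
    have h := ((h1 x hx).norm_sq.add (h2 x hx).norm_sq).const_add 1
    convert! h using 1
    rw [inner_add_right, real_inner_comm (v x) (v' x)]
    ring
  set F : ℝ → ℝ := fun x => E x * Real.exp (2 * K / x)
  have hF : ∀ x, 0 < x → HasDerivAt F
      ((2 * inner ℝ (v' x) (v x + v'' x) - E x * (2 * K / x ^ 2)) * Real.exp (2 * K / x)) x := by
    intro x hx
    have h := (hE' x hx).mul (((hasDerivAt_inv hx.ne').const_mul (2 * K)).exp)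
    convert! h using 1
    rw [← div_eq_mul_inv]
    field_simp
    ring
  have hanti : AntitoneOn F (Ici 1) := by
    refine antitoneOn_of_deriv_nonpos (convex_Ici 1)
      (fun x hx => (hF x (zero_lt_one.trans_le hx)).continuousAt.continuousWithinAt)
      (fun x hx => ?_) fun x hx => ?_
    · rw [interior_Ici] at hx
      exact (hF x (zero_lt_one.trans hx)).differentiableAt.differentiableWithinAt
    · rw [interior_Ici] at hx
      have hx0 : 0 < x := zero_lt_one.trans hx
      rw [(hF x hx0).deriv]
      refine mul_nonpos_of_nonpos_of_nonneg ?_ (Real.exp_nonneg _)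
      have i1 : inner ℝ (v' x) (v x + v'' x) ≤ ‖v' x‖ * (K * (‖v x‖ + 1) / x ^ 2) :=
        (real_inner_le_norm _ _).trans
          (mul_le_mul_of_nonneg_left (hK x (le_of_lt hx)) (norm_nonneg _))
      have i2 : ‖v' x‖ * (‖v x‖ + 1) ≤ E x := by
        simp only [hE]
        nlinarith [sq_nonneg (‖v' x‖ - ‖v x‖), sq_nonneg (‖v' x‖ - 1), sq_nonneg ‖v x‖]
      have i3 := mul_le_mul_of_nonneg_left i2 (by positivity : 0 ≤ 2 * K / x ^ 2)
      have i4 : 2 * (‖v' x‖ * (K * (‖v x‖ + 1) / x ^ 2)) =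
          2 * K / x ^ 2 * (‖v' x‖ * (‖v x‖ + 1)) := by ring
      linarith
  refine ⟨F 1, fun x hx => ?_⟩
  have hE1 : 1 ≤ E x := by simp only [hE]; linarith [sq_nonneg ‖v x‖, sq_nonneg ‖v' x‖]
  have j1 : ‖v x‖ ≤ E x := by
    simp only [hE]
    nlinarith [sq_nonneg (‖v x‖ - 1), sq_nonneg ‖v' x‖]
  have j2 : E x ≤ F x :=
    le_mul_of_one_le_right (by linarith) (Real.one_le_exp (by positivity))
  exact j1.trans (j2.trans (hanti (mem_Ici.2 le_rfl) hx hx))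

theorem norm_ofReal_cpow {x : ℝ} (hx : 0 < x) (s : ℂ) : ‖(x : ℂ) ^ s‖ = x ^ s.re :=
  Complex.norm_cpow_eq_rpow_re_of_pos hx s

theorem hasDerivAt_ofReal_cpow_pos {x : ℝ} (hx : 0 < x) (s : ℂ) :
    HasDerivAt (fun y : ℝ => (y : ℂ) ^ s) (s * (x : ℂ) ^ (s - 1)) x := by
  have h := (hasDerivAt_id (x : ℂ)).cpow_const (c := s) (Complex.ofReal_mem_slitPlane.2 hx)
  simpa using h.comp_ofReal

theorem ofReal_cpow_add_one {x : ℝ} (hx : 0 < x) (s : ℂ) :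
    (x : ℂ) ^ (s + 1) = (x : ℂ) ^ s * x := by
  rw [Complex.cpow_add _ _ (by exact_mod_cast hx.ne'), Complex.cpow_one]

/-- For `-1/2 < Re κ ≤ 1/2`, the function `√x 𝐇_κ(x)` is bounded on `[1, ∞)`. The function
`f = x^(κ+3/2) T_κ` solves `f'' = -f + (κ² - 1/4) x⁻² f + c x^(κ-1/2)`; subtracting the
leading term `c x^(κ-1/2)` leaves a perturbed oscillator. -/
theorem exists_norm_struveT_le_of_re_le {κ : ℂ} (hκ : -(1 / 2) < κ.re) (hκ' : κ.re ≤ 1 / 2) :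
    ∃ C, ∀ x : ℝ, 1 ≤ x → ‖(x : ℂ) ^ (κ + 3 / 2) * struveT κ x‖ ≤ C := by
  set c : ℂ := 2 * struveCoeff (κ - 1) 0 with hc
  set m : ℂ := κ ^ 2 - 1 / 4 with hm
  set d : ℂ := c * (κ - 1 / 2) * (κ - 3 / 2) with hd
  set v : ℝ → ℂ := fun x => (x : ℂ) ^ (κ + 3 / 2) * struveT κ x - c * (x : ℂ) ^ (κ - 1 / 2)
  set v' : ℝ → ℂ := fun x => (x : ℂ) ^ (κ + 1 / 2) *
    ((1 / 2 - κ) * struveT κ x + 2 * struveT (κ - 1) x) -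
      c * ((κ - 1 / 2) * (x : ℂ) ^ (κ - 3 / 2))
  set v'' : ℝ → ℂ := fun x => (x : ℂ) ^ (κ - 1 / 2) *
    ((m - x ^ 2) * struveT κ x + c) - d * (x : ℂ) ^ (κ - 5 / 2)
  have h1 : ∀ x, 0 < x → HasDerivAt v (v' x) x := by
    intro x hx
    have hx' : (x : ℂ) ≠ 0 := by exact_mod_cast hx.ne'
    have h := ((hasDerivAt_ofReal_cpow_pos hx (κ + 3 / 2)).mul (hasDerivAt_struveT hκ hx.ne')).sub
      ((hasDerivAt_ofReal_cpow_pos hx (κ - 1 / 2)).const_mul c)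
    convert! h using 1
    simp only [v']
    rw [show κ + 3 / 2 - 1 = κ + 1 / 2 by ring, show κ - 1 / 2 - 1 = κ - 3 / 2 by ring,
      show κ + 3 / 2 = κ + 1 / 2 + 1 by ring, ofReal_cpow_add_one hx]
    field_simp
    ring
  have h2 : ∀ x, 0 < x → HasDerivAt v' (v'' x) x := by
    intro x hx
    have hx' : (x : ℂ) ≠ 0 := by exact_mod_cast hx.ne'
    have h := ((hasDerivAt_ofReal_cpow_pos hx (κ + 1 / 2)).mul
      (((hasDerivAt_struveT hκ hx.ne').const_mul (1 / 2 - κ)).add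
        ((hasDerivAt_struveT_sub_one hκ hx.ne').const_mul 2))).sub
      (((hasDerivAt_ofReal_cpow_pos hx (κ - 3 / 2)).const_mul (κ - 1 / 2)).const_mul c)
    convert! h using 1
    simp only [v'', hm, hd, hc]
    rw [show κ + 1 / 2 - 1 = κ - 1 / 2 by ring, show κ - 3 / 2 - 1 = κ - 5 / 2 by ring,
      show κ + 1 / 2 = κ - 1 / 2 + 1 by ring, ofReal_cpow_add_one hx, Pi.add_apply]
    field_simp
    ring
  have hv : ∀ x, 0 < x → v x + v'' x =
      (m * v x + (m * c - d) * (x : ℂ) ^ (κ - 1 / 2)) / (x : ℂ) ^ 2 := by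
    intro x hx
    have hx' : (x : ℂ) ≠ 0 := by exact_mod_cast hx.ne'
    simp only [v, v'']
    rw [show κ + 3 / 2 = κ - 5 / 2 + 1 + 1 + 1 + 1 by ring,
      show κ - 1 / 2 = κ - 5 / 2 + 1 + 1 by ring]
    simp only [ofReal_cpow_add_one hx]
    field_simp
    ring
  have hpow : ∀ x : ℝ, 1 ≤ x → ‖(x : ℂ) ^ (κ - 1 / 2)‖ ≤ 1 := by
    intro x hx
    rw [norm_ofReal_cpow (by linarith)]
    exact Real.rpow_le_one_of_one_le_of_nonpos hx (by norm_num; linarith)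
  obtain ⟨C, hC⟩ := exists_norm_le_of_perturbed_oscillator (K := ‖m‖ + ‖m * c - d‖) h1 h2 <| by
    intro x hx
    rw [hv x (by linarith), norm_div, norm_pow, Complex.norm_real, Real.norm_eq_abs, sq_abs]
    gcongr
    calc ‖m * v x + (m * c - d) * (x : ℂ) ^ (κ - 1 / 2)‖
        ≤ ‖m‖ * ‖v x‖ + ‖m * c - d‖ * 1 := by
          refine (norm_add_le _ _).trans ?_
          rw [norm_mul, norm_mul]
          gcongr
          exact hpow x hx
      _ ≤ (‖m‖ + ‖m * c - d‖) * (‖v x‖ + 1) := by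
          nlinarith [norm_nonneg m, norm_nonneg (v x), norm_nonneg (m * c - d),
            mul_nonneg (norm_nonneg (m * c - d)) (norm_nonneg (v x))]
  refine ⟨C + ‖c‖ * 1, fun x hx => ?_⟩
  calc ‖(x : ℂ) ^ (κ + 3 / 2) * struveT κ x‖ = ‖v x + c * (x : ℂ) ^ (κ - 1 / 2)‖ := by
        simp only [v, sub_add_cancel]
    _ ≤ C + ‖c‖ * 1 := by
        refine (norm_add_le _ _).trans ?_
        rw [norm_mul]
        exact add_le_add (hC x hx) (mul_le_mul_of_nonneg_left (hpow x hx) (norm_nonneg _))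

/-! ### Mellin transforms of Laplace transforms -/

/-- The Mellin transform of a Laplace transform: interchange the integrals in
`∫∫ x^(c-1) e^(-xy) h(y) dy dx` and evaluate the integral over `x` as `Γ(c) y^(-c)`. -/
theorem mellin_laplace {h : ℝ → ℂ} {c : ℂ} (hc : 0 < c.re) (hh : MellinConvergent h (1 - c)) :
    mellin (fun x => ∫ y in Ioi (0 : ℝ), Complex.exp (-(x * y)) * h y) c =
      Complex.Gamma c * mellin h (1 - c) := by
  set F : ℝ → ℝ → ℂ := fun y x => (x : ℂ) ^ (c - 1) * (Complex.exp (-(y * x)) * h y) with hF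
  have hinner : ∀ y ∈ Ioi (0 : ℝ), ∫ x in Ioi (0 : ℝ), F y x =
      Complex.Gamma c * ((y : ℂ) ^ (1 - c - 1) • h y) := by
    intro y hy
    have h1 := Complex.integral_cpow_mul_exp_neg_mul_Ioi hc hy
    simp only [hF]
    simp_rw [← mul_assoc]
    rw [integral_mul_const, h1, one_div, Complex.inv_cpow _ _ (by
      rw [Complex.arg_ofReal_of_nonneg (le_of_lt hy)]; exact Real.pi_pos.ne),
      ← Complex.cpow_neg, smul_eq_mul]
    ring_nf
  have hint : Integrable (Function.uncurry F)
      ((volume.restrict (Ioi (0 : ℝ))).prod (volume.restrict (Ioi (0 : ℝ)))) := by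
    have hmeas : AEStronglyMeasurable (Function.uncurry F)
        ((volume.restrict (Ioi (0 : ℝ))).prod (volume.restrict (Ioi (0 : ℝ)))) := by
      have m1 : AEStronglyMeasurable (fun z : ℝ × ℝ => (z.1 : ℂ) ^ (1 - c - 1) • h z.1)
          ((volume.restrict (Ioi (0 : ℝ))).prod (volume.restrict (Ioi (0 : ℝ)))) :=
        hh.aestronglyMeasurable.comp_fst
      have m2 : Measurable (fun z : ℝ × ℝ =>
          (z.2 : ℂ) ^ (c - 1) * Complex.exp (-(z.1 * z.2)) * (z.1 : ℂ) ^ c) := by fun_prop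
      refine (m2.aestronglyMeasurable.mul m1).congr ?_
      rw [Measure.prod_restrict]
      filter_upwards [ae_restrict_mem (measurableSet_Ioi.prod measurableSet_Ioi)] with z hz
      have hz1 : (z.1 : ℂ) ≠ 0 := by exact_mod_cast (ne_of_gt hz.1)
      have e : (z.1 : ℂ) ^ c * (z.1 : ℂ) ^ (1 - c - 1) = 1 := by
        rw [← Complex.cpow_add _ _ hz1]; simp
      simp only [Pi.mul_apply, Function.uncurry, hF, smul_eq_mul]
      linear_combination (z.2 : ℂ) ^ (c - 1) * Complex.exp (-(z.1 * z.2)) * h z.1 * e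
    have hnorm : ∀ y ∈ Ioi (0 : ℝ), ∀ x ∈ Ioi (0 : ℝ),
        ‖F y x‖ = x ^ (c.re - 1) * Real.exp (-(y * x)) * ‖h y‖ := by
      intro y _ x hx
      simp only [hF]
      rw [norm_mul, norm_mul, Complex.norm_cpow_eq_rpow_re_of_pos hx, Complex.norm_exp]
      simp [mul_assoc]
    refine (integrable_prod_iff hmeas).2 ⟨?_, ?_⟩
    · filter_upwards [ae_restrict_mem measurableSet_Ioi] with y hy
      have h1 := integrableOn_rpow_mul_exp_neg_mul_rpow (p := 1) (s := c.re - 1) (b := y)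
        (by linarith) one_pos hy
      refine (integrable_norm_iff ?_).1 ?_
      · have : Measurable fun x => F y x := by
          simp only [hF]
          fun_prop
        exact this.aestronglyMeasurable
      · refine (Integrable.mul_const h1 ‖h y‖).congr ?_
        filter_upwards [ae_restrict_mem measurableSet_Ioi] with x hx
        simp only [Function.uncurry]
        rw [hnorm y hy x hx, Real.rpow_one, neg_mul]
    · refine (hh.norm.const_mul (Real.Gamma c.re)).congr ?_
      filter_upwards [ae_restrict_mem measurableSet_Ioi] with y hy
      simp only [Function.uncurry]
      rw [setIntegral_congr_fun measurableSet_Ioi (hnorm y hy), integral_mul_const,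
        Real.integral_rpow_mul_exp_neg_mul_Ioi hc hy, norm_smul,
        Complex.norm_cpow_eq_rpow_re_of_pos hy, one_div, Real.inv_rpow (le_of_lt hy),
        ← Real.rpow_neg (le_of_lt hy)]
      simp
      ring
  have e1 : mellin (fun x => ∫ y in Ioi (0 : ℝ), Complex.exp (-(x * y)) * h y) c =
      ∫ x in Ioi (0 : ℝ), ∫ y in Ioi (0 : ℝ), F y x := by
    simp only [mellin, smul_eq_mul, hF, ← integral_const_mul, mul_comm]
  rw [e1, ← integral_integral_swap hint, setIntegral_congr_fun measurableSet_Ioi hinner,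
    integral_const_mul, mellin]

/-- `1 / (1 + x)` is the Laplace transform of `exp (-y)`; Euler's reflection formula does the rest. -/
theorem mellin_one_div_one_add {c : ℂ} (hc : 0 < c.re) (hc1 : c.re < 1) :
    mellin (fun x : ℝ => (1 / (1 + x) : ℂ)) c = Real.pi / Complex.sin (Real.pi * c) := by
  have hc' : 0 < (1 - c).re := by simpa using hc1
  have hG : mellin (fun y : ℝ => (Real.exp (-y) : ℂ)) (1 - c) = Complex.Gamma (1 - c) := by
    rw [← Complex.GammaIntegral_eq_mellin, Complex.Gamma_eq_integral hc']
  have hconv : MellinConvergent (fun y : ℝ => (Real.exp (-y) : ℂ)) (1 - c) := by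
    refine (Complex.GammaIntegral_convergent hc').congr_fun (fun x _ => ?_) measurableSet_Ioi
    simp [mul_comm]
  have h := mellin_laplace hc hconv
  rw [hG, Complex.Gamma_mul_Gamma_one_sub] at h
  rw [← h, mellin, mellin]
  refine setIntegral_congr_fun measurableSet_Ioi fun x hx => ?_
  have hx' : 0 < x := hx
  have e := integral_exp_mul_complex_Ioi (a := -(x + 1 : ℂ)) (by simp; linarith) 0
  congr 1
  have : ∀ y : ℝ, Complex.exp (-(x * y)) * (Real.exp (-y) : ℂ) =
      Complex.exp (-(x + 1 : ℂ) * y) := by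
    intro y
    rw [Complex.ofReal_exp, ← Complex.exp_add]
    congr 1
    push_cast
    ring
  simp_rw [this, e]
  rw [neg_div_neg_eq, Complex.ofReal_zero, mul_zero, Complex.exp_zero, add_comm (x : ℂ)]

theorem mellin_one_div_one_add_sq {c : ℂ} (hc : 0 < c.re) (hc2 : c.re < 2) :
    mellin (fun x : ℝ => (1 / (1 + x ^ 2) : ℂ)) c =
      Real.pi / (2 * Complex.sin (Real.pi * (c / 2))) := by
  have h := mellin_comp_rpow (fun x : ℝ => (1 / (1 + x) : ℂ)) c 2
  rw [Complex.ofReal_ofNat, mellin_one_div_one_add (c := c / 2) (by simpa using hc)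
    (by simp; linarith)] at h
  simp only [Real.rpow_ofNat, Complex.ofReal_pow] at h
  rw [h]
  simp
  ring

theorem one_sub_cos_le_sq (u : ℝ) : 1 - Real.cos u ≤ u ^ 2 := by
  have := Real.one_sub_sq_div_two_le_cos (x := u)
  nlinarith [sq_nonneg u]

theorem norm_one_sub_cos (u : ℝ) : ‖(1 - Complex.cos u : ℂ)‖ = 1 - Real.cos u := by
  rw [← Complex.ofReal_cos, ← Complex.ofReal_one, ← Complex.ofReal_sub, Complex.norm_real,
    Real.norm_of_nonneg (by linarith [Real.cos_le_one u])]

theorem mellinConvergent_one_sub_cos {q : ℂ} (hq : -2 < q.re) (hq0 : q.re < 0) :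
    MellinConvergent (fun u : ℝ => (1 - Complex.cos u : ℂ)) q := by
  refine mellinConvergent_of_isBigO_rpow (a := 0) (b := -2) ?_ ?_ hq0 ?_ hq
  · exact (Continuous.locallyIntegrable (by fun_prop)).locallyIntegrableOn _
  · refine Asymptotics.IsBigO.of_bound 2 (Eventually.of_forall fun u => ?_)
    rw [norm_one_sub_cos]
    simp
    linarith [Real.neg_one_le_cos u]
  · refine Asymptotics.IsBigO.of_bound 1 ?_
    filter_upwards [self_mem_nhdsWithin] with u hu
    rw [norm_one_sub_cos, neg_neg, Real.rpow_ofNat, one_mul, Real.norm_of_nonneg (sq_nonneg u)]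
    exact one_sub_cos_le_sq u

theorem integral_exp_neg_mul_one_sub_cos {x : ℝ} (hx : 0 < x) :
    ∫ y in Ioi (0 : ℝ), Complex.exp (-(x * y)) * (1 - Complex.cos y) =
      (x : ℂ) ^ (-1 : ℂ) * (1 / (1 + (x : ℂ) ^ 2)) := by
  have hx' : (x : ℂ) ≠ 0 := by exact_mod_cast hx.ne'
  have i0 := integral_exp_mul_complex_Ioi (a := -(x : ℂ)) (by simpa using hx) 0
  have i1 := integral_exp_mul_complex_Ioi (a := -(x : ℂ) + Complex.I) (by simpa using hx) 0
  have i2 := integral_exp_mul_complex_Ioi (a := -(x : ℂ) - Complex.I) (by simpa using hx) 0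
  have j0 := integrableOn_exp_mul_complex_Ioi (a := -(x : ℂ)) (by simpa using hx) 0
  have j1 := integrableOn_exp_mul_complex_Ioi (a := -(x : ℂ) + Complex.I) (by simpa using hx) 0
  have j2 := integrableOn_exp_mul_complex_Ioi (a := -(x : ℂ) - Complex.I) (by simpa using hx) 0
  have e : ∀ y : ℝ, Complex.exp (-(x * y)) * (1 - Complex.cos y) =
      Complex.exp (-(x : ℂ) * y) - (Complex.exp ((-(x : ℂ) + Complex.I) * y) +
        Complex.exp ((-(x : ℂ) - Complex.I) * y)) / 2 := by
    intro y
    rw [Complex.cos, add_mul, sub_mul, sub_eq_add_neg _ (Complex.I * y), Complex.exp_add,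
      Complex.exp_add]
    ring_nf
  simp_rw [e]
  have k : ∫ y in Ioi (0 : ℝ), (Complex.exp ((-(x : ℂ) + Complex.I) * y) +
      Complex.exp ((-(x : ℂ) - Complex.I) * y)) / 2 = _ :=
    (integral_div _ _).trans (congrArg (· / 2) (integral_add j1 j2))
  refine (integral_sub j0 (Integrable.div_const (Integrable.add j1 j2) 2)).trans ?_
  refine (congrArg (_ - ·) k).trans ?_
  rw [i0, i1, i2]
  have n1 : -(x : ℂ) + Complex.I ≠ 0 := fun h => by simpa using congrArg Complex.im h
  have n2 : -(x : ℂ) - Complex.I ≠ 0 := fun h => by simpa using congrArg Complex.im h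
  have n3 : 1 + (x : ℂ) ^ 2 ≠ 0 := by
    exact_mod_cast (by positivity : 1 + x ^ 2 ≠ 0)
  rw [Complex.cpow_neg_one]
  simp only [Complex.ofReal_zero, mul_zero, Complex.exp_zero]
  field_simp
  ring_nf
  simp only [Complex.I_sq]
  ring

/-- The Mellin transform of `1 - cos`, from that of its Laplace transform `1 / (x (1 + x²))`. -/
theorem mellin_one_sub_cos {q : ℂ} (hq : -2 < q.re) (hq0 : q.re < 0) :
    mellin (fun u : ℝ => (1 - Complex.cos u : ℂ)) q =
      Real.pi / (2 * Complex.Gamma (1 - q) * Complex.sin (Real.pi * (-q / 2))) := by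
  have hc : 0 < (1 - q).re := by simp; linarith
  have h := mellin_laplace (h := fun u : ℝ => (1 - Complex.cos u : ℂ)) (c := 1 - q) hc
    (by simpa using mellinConvergent_one_sub_cos hq hq0)
  rw [sub_sub_cancel] at h
  have h2 := mellin_cpow_smul (fun x : ℝ => (1 / (1 + x ^ 2) : ℂ)) (1 - q) (-1)
  rw [show 1 - q + -1 = -q by ring, mellin_one_div_one_add_sq (by simpa using hq0)
    (by simp; linarith)] at h2
  have h3 : mellin (fun x => ∫ y in Ioi (0 : ℝ), Complex.exp (-(x * y)) * (1 - Complex.cos y))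
      (1 - q) = mellin (fun x : ℝ => (x : ℂ) ^ (-1 : ℂ) • (1 / (1 + x ^ 2) : ℂ)) (1 - q) := by
    refine setIntegral_congr_fun measurableSet_Ioi fun x hx => ?_
    simp only [integral_exp_neg_mul_one_sub_cos hx, smul_eq_mul]
  rw [h3, h2] at h
  have hG := Complex.Gamma_ne_zero_of_re_pos hc
  rw [mul_comm 2, mul_assoc, ← div_div, div_right_comm, h, mul_div_cancel_left₀ _ hG]

/-! ### The integral representation for large order -/

theorem intervalIntegrable_one_sub_cpow {s : ℂ} (hs : -1 < s.re) :
    IntervalIntegrable (fun r : ℝ => (1 - (r : ℂ)) ^ s) volume 0 1 := by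
  have h := Complex.betaIntegral_convergent (u := 1) (v := s + 1) (by simp) (by simp; linarith)
  simpa using h

theorem hasSum_one_sub_cos_mul_sqrt (x : ℝ) {r : ℝ} (hr : 0 ≤ r) :
    HasSum (fun n : ℕ => (-1) ^ n * (x : ℂ) ^ (2 * n + 2) / ((2 * n + 2).factorial : ℂ) *
      (r : ℂ) ^ (n + 1)) (1 - Complex.cos (x * Real.sqrt r)) := by
  have h := (hasSum_nat_add_iff' 1).2 (Complex.hasSum_cos (x * Real.sqrt r))
  have h2 := h.neg
  convert! h2 using 1
  · funext n
    have : (Real.sqrt r : ℂ) ^ 2 = r := by exact_mod_cast Real.sq_sqrt hr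
    rw [mul_pow, pow_mul (Real.sqrt r : ℂ), this, show 2 * (n + 1) = 2 * n + 2 by ring, pow_succ (-1)]
    ring
  · simp

theorem gamma_duplication_nat (n : ℕ) :
    Complex.Gamma (n + 3 / 2) * Complex.Gamma (n + 2) =
      (2 * n + 2).factorial * (Real.sqrt Real.pi : ℂ) / (4 * 2 ^ (2 * n)) := by
  have h := Complex.Gamma_mul_Gamma_add_half (n + 3 / 2)
  have h2 : Complex.Gamma (2 * ((n : ℂ) + 3 / 2)) = (2 * n + 2).factorial := by
    rw [← Complex.Gamma_nat_eq_factorial]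
    congr 1
    push_cast
    ring
  rw [show (n : ℂ) + 3 / 2 + 1 / 2 = n + 2 by ring, h2,
    show 1 - 2 * ((n : ℂ) + 3 / 2) = -((2 * n + 2 : ℕ) : ℂ) by push_cast; ring,
    Complex.cpow_neg, Complex.cpow_natCast, pow_add] at h
  rw [h]
  field_simp
  norm_num

/-- The integral representation of `T_ν` for `Re ν > 1/2`: expand the cosine, whose terms integrate
to Beta values. -/
theorem integral_one_sub_cpow_mul_one_sub_cos {ν : ℂ} (hν : 1 / 2 < ν.re) (x : ℝ) :
    ∫ r in (0 : ℝ)..1, (1 - (r : ℂ)) ^ (ν - 3 / 2) * (1 - Complex.cos (x * Real.sqrt r)) =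
      Real.sqrt Real.pi * Complex.Gamma (ν - 1 / 2) / 4 * ((x : ℂ) ^ 2 * struveT ν x) := by
  have hs : -1 < (ν - 3 / 2).re := by norm_num; linarith
  have hk := intervalIntegrable_one_sub_cpow hs
  have hsum : Summable fun n : ℕ => |x| ^ (2 * n + 2) / (2 * n + 2).factorial := by
    have h := (Real.hasSum_cosh |x|).summable
    have := (summable_nat_add_iff 1).2 h
    exact this
  have h := intervalIntegral.hasSum_integral_of_dominated_convergence (μ := volume) (a := 0) (b := 1)
    (F := fun (n : ℕ) (r : ℝ) => (1 - (r : ℂ)) ^ (ν - 3 / 2) *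
      ((-1) ^ n * (x : ℂ) ^ (2 * n + 2) / ((2 * n + 2).factorial : ℂ) * (r : ℂ) ^ (n + 1)))
    (f := fun r => (1 - (r : ℂ)) ^ (ν - 3 / 2) * (1 - Complex.cos (x * Real.sqrt r)))
    (fun n r => ‖(1 - (r : ℂ)) ^ (ν - 3 / 2)‖ * (|x| ^ (2 * n + 2) / (2 * n + 2).factorial))
    (fun n => (by fun_prop : Measurable _).aestronglyMeasurable)
    (fun n => Eventually.of_forall fun r hr => by
      rw [uIoc_of_le zero_le_one] at hr
      rw [norm_mul]
      gcongr
      simp only [norm_mul, norm_div, norm_pow, norm_neg, norm_one, one_pow, one_mul,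
        Complex.norm_real, Complex.norm_natCast, Real.norm_eq_abs]
      refine mul_le_of_le_one_right (by positivity) (pow_le_one₀ (abs_nonneg _) ?_)
      rw [abs_of_pos hr.1]
      exact hr.2)
    (Eventually.of_forall fun r _ => hsum.mul_left _)
    (by
      simp_rw [tsum_mul_left]
      exact hk.norm.mul_const _)
    (Eventually.of_forall fun r hr => by
      rw [uIoc_of_le zero_le_one] at hr
      exact (hasSum_one_sub_cos_mul_sqrt x hr.1.le).mul_left _)
  rw [← h.tsum_eq, struveT, ← tsum_mul_left, ← tsum_mul_left]
  refine tsum_congr fun n => ?_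
  have hb : ∫ r in (0 : ℝ)..1, (1 - (r : ℂ)) ^ (ν - 3 / 2) *
      ((-1) ^ n * (x : ℂ) ^ (2 * n + 2) / ((2 * n + 2).factorial : ℂ) * (r : ℂ) ^ (n + 1)) =
      (-1) ^ n * (x : ℂ) ^ (2 * n + 2) / ((2 * n + 2).factorial : ℂ) *
        Complex.betaIntegral (n + 2) (ν - 1 / 2) := by
    rw [Complex.betaIntegral, ← intervalIntegral.integral_const_mul]
    refine intervalIntegral.integral_congr fun r _ => ?_
    rw [show (n : ℂ) + 2 - 1 = ((n + 1 : ℕ) : ℂ) by push_cast; ring, Complex.cpow_natCast,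
      show ν - 1 / 2 - 1 = ν - 3 / 2 by ring]
    ring
  have g1 := gamma_natCast_add_ne_zero (s := 3 / 2) (by norm_num) n
  have g2 := gamma_natCast_add_ne_zero (s := ν + 3 / 2) (by norm_num; linarith) n
  have hf : ((2 * n + 2).factorial : ℂ) ≠ 0 := by exact_mod_cast Nat.factorial_ne_zero _
  rw [hb, Complex.betaIntegral_eq_Gamma_mul_div _ _ (by norm_num; positivity)
    (by norm_num; linarith), struveCoeff, eq_div_of_mul_eq g1 ((mul_comm _ _).trans
      (gamma_duplication_nat n)), show (n : ℂ) + 2 + (ν - 1 / 2) = n + (ν + 3 / 2) by ring,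
      show (n : ℂ) + ν + 3 / 2 = n + (ν + 3 / 2) by ring]
  generalize Complex.Gamma (n + (ν + 3 / 2)) = G2 at g2 ⊢
  generalize Complex.Gamma (n + 3 / 2) = G1 at g1 ⊢
  generalize ((2 * n + 2).factorial : ℂ) = N at hf ⊢
  rw [div_pow, div_pow, ← pow_mul, ← pow_mul, pow_add]
  field_simp

theorem gamma_sub_half_ne_zero {ν : ℂ} (hν : 1 / 2 < ν.re) : Complex.Gamma (ν - 1 / 2) ≠ 0 :=
  Complex.Gamma_ne_zero_of_re_pos (by norm_num; linarith)

theorem sqrt_pi_ne_zero : (Real.sqrt Real.pi : ℂ) ≠ 0 := by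
  exact_mod_cast (Real.sqrt_pos.2 Real.pi_pos).ne'

theorem struveT_eq_integral {ν : ℂ} (hν : 1 / 2 < ν.re) {x : ℝ} (hx : x ≠ 0) :
    struveT ν x = 4 / (Real.sqrt Real.pi * Complex.Gamma (ν - 1 / 2)) / (x : ℂ) ^ 2 *
      ∫ r in Ioc (0 : ℝ) 1, (1 - (r : ℂ)) ^ (ν - 3 / 2) * (1 - Complex.cos (x * Real.sqrt r)) := by
  have hx' : (x : ℂ) ≠ 0 := by exact_mod_cast hx
  have h1 := sqrt_pi_ne_zero
  have h2 := gamma_sub_half_ne_zero hν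
  rw [← intervalIntegral.integral_of_le zero_le_one, integral_one_sub_cpow_mul_one_sub_cos hν]
  generalize Complex.Gamma (ν - 1 / 2) = G at h2 ⊢
  field_simp

theorem exists_norm_struveT_le_of_lt_re {ν : ℂ} (hν : 1 / 2 < ν.re) :
    ∃ C, ∀ x : ℝ, 0 < x → ‖struveT ν x‖ ≤ C / x ^ 2 := by
  have hs : -1 < (ν - 3 / 2).re := by norm_num; linarith
  have hk := (intervalIntegrable_iff_integrableOn_Ioc_of_le zero_le_one).1
    (intervalIntegrable_one_sub_cpow hs)
  refine ⟨‖4 / (Real.sqrt Real.pi * Complex.Gamma (ν - 1 / 2))‖ *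
    ∫ r in Ioc (0 : ℝ) 1, ‖(1 - (r : ℂ)) ^ (ν - 3 / 2)‖ * 2, fun x hx => ?_⟩
  rw [struveT_eq_integral hν hx.ne', norm_mul, norm_div _ ((x : ℂ) ^ 2), norm_pow,
    Complex.norm_real, Real.norm_eq_abs, sq_abs, div_mul_eq_mul_div]
  gcongr
  refine norm_integral_le_of_norm_le (hk.norm.mul_const 2) (Eventually.of_forall fun r => ?_)
  rw [norm_mul, ← Complex.ofReal_mul, norm_one_sub_cos]
  gcongr
  linarith [Real.neg_one_le_cos (x * Real.sqrt r)]

/-! ### The Mellin transform of the Struve function of large order -/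

theorem ofReal_sqrt_cpow {r : ℝ} (hr : 0 < r) (s : ℂ) :
    (Real.sqrt r : ℂ) ^ s = (r : ℂ) ^ (s / 2) := by
  have h : (Real.sqrt r : ℂ) ≠ 0 := by exact_mod_cast (Real.sqrt_pos.2 hr).ne'
  have h' : (r : ℂ) ≠ 0 := by exact_mod_cast hr.ne'
  rw [Complex.cpow_def_of_ne_zero h, Complex.cpow_def_of_ne_zero h',
    ← Complex.ofReal_log (Real.sqrt_nonneg r), ← Complex.ofReal_log hr.le, Real.log_sqrt hr.le]
  push_cast
  ring_nf

/-- The integrand of the iterated integral that gives the Mellin transform of `T_ν` is absolutely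
integrable, being dominated by the product of `u^(Re p - 2) min (2, u²)` and the Beta kernel. -/
theorem integrable_mellin_kernel {p ν : ℂ} (hp : -1 < p.re) (hp1 : p.re < 1) (hν : 1 / 2 < ν.re) :
    Integrable (Function.uncurry fun u r : ℝ => (u : ℂ) ^ (p - 2) *
      ((1 - (r : ℂ)) ^ (ν - 3 / 2) * (1 - Complex.cos (u * Real.sqrt r))))
      ((volume.restrict (Ioi (0 : ℝ))).prod (volume.restrict (Ioc (0 : ℝ) 1))) := by
  have hs : -1 < (ν - 3 / 2).re := by norm_num; linarith
  have hk := (intervalIntegrable_iff_integrableOn_Ioc_of_le zero_le_one).1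
    (intervalIntegrable_one_sub_cpow hs)
  have hh : MellinConvergent (fun u : ℝ => ((min 2 (u ^ 2) : ℝ) : ℂ)) (p - 1) := by
    have hn : ∀ u : ℝ, ‖((min 2 (u ^ 2) : ℝ) : ℂ)‖ = min 2 (u ^ 2) := fun u => by
      rw [Complex.norm_real, Real.norm_of_nonneg (by positivity)]
    refine mellinConvergent_of_isBigO_rpow (a := 0) (b := -2) ?_ ?_ (by simpa using hp1) ?_
      (by simp; linarith)
    · exact (Continuous.locallyIntegrable (by fun_prop)).locallyIntegrableOn _
    · refine Asymptotics.IsBigO.of_bound 2 (Eventually.of_forall fun u => ?_)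
      rw [hn]
      simp
    · refine Asymptotics.IsBigO.of_bound 1 (Eventually.of_forall fun u => ?_)
      rw [hn, neg_neg, Real.rpow_ofNat, one_mul, Real.norm_of_nonneg (sq_nonneg u)]
      exact min_le_right _ _
  refine (hh.mul_prod hk).mono (by fun_prop : Measurable _).aestronglyMeasurable ?_
  rw [Measure.prod_restrict]
  filter_upwards [ae_restrict_mem (measurableSet_Ioi.prod measurableSet_Ioc)] with z hz
  obtain ⟨hz1, hz2⟩ := hz
  have hu : 0 < z.1 := hz1
  simp only [Function.uncurry, smul_eq_mul, norm_mul]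
  rw [show p - 1 - 1 = p - 2 by ring, ← Complex.ofReal_mul, norm_one_sub_cos, Complex.norm_real,
    Real.norm_of_nonneg (by positivity), mul_assoc, mul_comm (min _ _)]
  gcongr
  refine le_min (by linarith [Real.neg_one_le_cos (z.1 * Real.sqrt z.2)])
    ((one_sub_cos_le_sq _).trans ?_)
  rw [mul_pow, Real.sq_sqrt hz2.1.le]
  exact mul_le_of_le_one_right (by positivity) hz2.2

theorem integral_cpow_mul_one_sub_cos_mul_sqrt (p : ℂ) {r : ℝ} (hr : 0 < r) :
    ∫ u in Ioi (0 : ℝ), (u : ℂ) ^ (p - 2) * (1 - Complex.cos (u * Real.sqrt r)) =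
      (r : ℂ) ^ ((1 - p) / 2) * mellin (fun u : ℝ => (1 - Complex.cos u : ℂ)) (p - 1) := by
  have h := mellin_comp_mul_left (fun u : ℝ => (1 - Complex.cos u : ℂ)) (p - 1)
    (Real.sqrt_pos.2 hr)
  rw [ofReal_sqrt_cpow hr, smul_eq_mul, show -(p - 1) = 1 - p by ring] at h
  rw [← h, mellin]
  refine setIntegral_congr_fun measurableSet_Ioi fun u _ => ?_
  simp only [smul_eq_mul, Complex.ofReal_mul]
  rw [show p - 1 - 1 = p - 2 by ring, mul_comm (u : ℂ)]

/-- The value of `∫₀^∞ u^p T_ν(u) du`. At a pole of `Γ(ν + 1 - p/2)` it is `0`, because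
`Complex.Gamma` is `0` there and division by `0` gives `0`. -/
noncomputable def struveMellin (p ν : ℂ) : ℂ :=
  2 ^ p * Real.pi /
    (Complex.Gamma (1 - p / 2) * Complex.cos (Real.pi * (p / 2)) * Complex.Gamma (ν + 1 - p / 2))

/-- Legendre duplication brings the constant produced by the iterated integral into closed form. -/
theorem struveMellin_eq {p ν : ℂ} (hp1 : p.re < 1) (hν : 1 / 2 < ν.re) :
    4 / (Real.sqrt Real.pi * Complex.Gamma (ν - 1 / 2)) *
      (Complex.betaIntegral ((3 - p) / 2) (ν - 1 / 2) *
        (Real.pi / (2 * Complex.Gamma (1 - (p - 1)) * Complex.sin (Real.pi * (-(p - 1) / 2))))) =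
    struveMellin p ν := by
  have h3 : 0 < ((3 - p) / 2).re := by simp; linarith
  have g3 := Complex.Gamma_ne_zero_of_re_pos h3
  have g1 : Complex.Gamma (1 - p / 2) ≠ 0 :=
    Complex.Gamma_ne_zero_of_re_pos (by simp; linarith)
  have g2 := gamma_sub_half_ne_zero hν
  have hd := Complex.Gamma_mul_Gamma_add_half (1 - p / 2)
  rw [show 1 - p / 2 + 1 / 2 = (3 - p) / 2 by ring, show 2 * (1 - p / 2) = 2 - p by ring,
    show 1 - (2 - p) = p - 1 by ring, Complex.cpow_sub _ _ two_ne_zero, Complex.cpow_one] at hd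
  have h2p : (2 : ℂ) ^ p ≠ 0 := by simp [Complex.cpow_eq_zero_iff]
  have hπ := sqrt_pi_ne_zero
  have hΓ : Complex.Gamma (2 - p) =
      Complex.Gamma (1 - p / 2) * Complex.Gamma ((3 - p) / 2) * 2 /
        (2 ^ p * Real.sqrt Real.pi) := by
    rw [hd]
    field_simp
  rw [Complex.betaIntegral_eq_Gamma_mul_div _ _ h3 (by norm_num; linarith), struveMellin,
    show 1 - (p - 1) = 2 - p by ring, hΓ,
    show (Real.pi : ℂ) * (-(p - 1) / 2) = Real.pi / 2 - Real.pi * (p / 2) by ring,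
    Complex.sin_pi_div_two_sub, show (3 - p) / 2 + (ν - 1 / 2) = ν + 1 - p / 2 by ring]
  generalize Complex.Gamma (1 - p / 2) = G1 at g1 ⊢
  generalize Complex.Gamma ((3 - p) / 2) = G3 at g3 ⊢
  generalize Complex.Gamma (ν - 1 / 2) = G2 at g2 ⊢
  generalize Complex.Gamma (ν + 1 - p / 2) = G4
  generalize Complex.cos (Real.pi * (p / 2)) = c
  field_simp
  norm_num

/-- The absolutely convergent case: insert the integral representation, interchange the integrals,
and use the Mellin transform of `1 - cos` for the inner and the Beta integral for the outer one. -/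
theorem integrableOn_and_integral_struveT {p ν : ℂ} (hp : -1 < p.re) (hp1 : p.re < 1)
    (hν : 1 / 2 < ν.re) :
    IntegrableOn (fun u : ℝ => (u : ℂ) ^ p * struveT ν u) (Ioi 0) ∧
      ∫ u in Ioi (0 : ℝ), (u : ℂ) ^ p * struveT ν u = struveMellin p ν := by
  have hint := integrable_mellin_kernel hp hp1 hν
  set A : ℂ := 4 / (Real.sqrt Real.pi * Complex.Gamma (ν - 1 / 2)) with hA
  have heq : ∀ u ∈ Ioi (0 : ℝ), A * (∫ r in Ioc (0 : ℝ) 1, (u : ℂ) ^ (p - 2) *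
      ((1 - (r : ℂ)) ^ (ν - 3 / 2) * (1 - Complex.cos (u * Real.sqrt r)))) =
        (u : ℂ) ^ p * struveT ν u := by
    intro u hu
    have hu' : (u : ℂ) ≠ 0 := by exact_mod_cast (ne_of_gt hu)
    rw [integral_const_mul, struveT_eq_integral hν (ne_of_gt hu), Complex.cpow_sub _ _ hu']
    norm_num
    ring
  constructor
  · exact IntegrableOn.congr_fun (hint.integral_prod_left.const_mul A) heq measurableSet_Ioi
  · rw [← setIntegral_congr_fun measurableSet_Ioi heq, integral_const_mul,
      integral_integral_swap hint, ← struveMellin_eq hp1 hν]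
    congr 1
    rw [← mellin_one_sub_cos (q := p - 1) (by simp; linarith) (by simpa using hp1),
      Complex.betaIntegral, intervalIntegral.integral_of_le zero_le_one, ← integral_mul_const]
    refine setIntegral_congr_fun measurableSet_Ioc fun r hr => ?_
    have h := integral_cpow_mul_one_sub_cos_mul_sqrt p hr.1
    simp_rw [mul_left_comm _ ((1 - (r : ℂ)) ^ (ν - 3 / 2))]
    rw [integral_const_mul, h, show (3 - p) / 2 - 1 = (1 - p) / 2 by ring,
      show ν - 1 / 2 - 1 = ν - 3 / 2 by ring]
    ring

/-! ### Lowering the order -/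

theorem intervalIntegrable_cpow_mul_struveT {p ν : ℂ} (hp : -1 < p.re) (hν : -(3 / 2) < ν.re)
    (R : ℝ) : IntervalIntegrable (fun u : ℝ => (u : ℂ) ^ p * struveT ν u) volume 0 R :=
  (intervalIntegral.intervalIntegrable_cpow' hp).mul_continuousOn
    (continuous_struveT hν).continuousOn

/-- The boundary term at infinity of the integration by parts that lowers the order vanishes. It is
`O(R^(Re p - 1))` for `Re κ > 1/2`, and `O(R^(Re (p - κ) - 1/2))` otherwise. -/
theorem tendsto_cpow_mul_struveT {p κ : ℂ} (hp1 : p.re < 1) (hκ : -(1 / 2) < κ.re)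
    (hpκ : (p - κ).re < 1 / 2) :
    Tendsto (fun R : ℝ => (R : ℂ) ^ (p + 1) * struveT κ R) atTop (𝓝 0) := by
  obtain ⟨C, t, ht, hC⟩ : ∃ C t : ℝ, 0 < t ∧
      ∀ x : ℝ, 1 ≤ x → ‖(x : ℂ) ^ (p + 1) * struveT κ x‖ ≤ C * x ^ (-t) := by
    rcases lt_or_ge (1 / 2) κ.re with h | h
    · obtain ⟨C, hC⟩ := exists_norm_struveT_le_of_lt_re h
      refine ⟨C, 1 - p.re, by linarith, fun x hx => ?_⟩
      have hx0 : 0 < x := by linarith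
      rw [norm_mul, norm_ofReal_cpow hx0]
      calc x ^ (p + 1).re * ‖struveT κ x‖ ≤ x ^ (p + 1).re * (C / x ^ 2) := by
            gcongr
            exact hC x hx0
        _ = C * x ^ (-(1 - p.re)) := by
            rw [show -(1 - p.re) = (p + 1).re - (2 : ℕ) by simp; ring, Real.rpow_sub hx0,
              Real.rpow_natCast]
            ring
    · obtain ⟨C, hC⟩ := exists_norm_struveT_le_of_re_le hκ h
      refine ⟨C, 1 / 2 - (p - κ).re, by linarith, fun x hx => ?_⟩
      have hx0 : 0 < x := by linarith
      have hx' : (x : ℂ) ≠ 0 := by exact_mod_cast hx0.ne'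
      rw [show p + 1 = (κ + 3 / 2) + (p - κ - 1 / 2) by ring, Complex.cpow_add _ _ hx',
        mul_right_comm, norm_mul, norm_ofReal_cpow hx0,
        show -(1 / 2 - (p - κ).re) = (p - κ - 1 / 2).re by simp]
      gcongr
      exact hC x hx
  refine squeeze_zero_norm' (eventually_atTop.2 ⟨1, hC⟩) ?_
  simpa using (tendsto_rpow_neg_atTop ht).const_mul C

/-- Integration by parts, using `(x^(ν+1) 𝐇_{ν+1})' = x^(ν+1) 𝐇_ν`. -/
theorem integral_cpow_mul_struveT {p ν : ℂ} (hp : -1 < p.re) (hν : -(3 / 2) < ν.re) {R : ℝ}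
    (hR : 0 < R) :
    ∫ u in (0 : ℝ)..R, (u : ℂ) ^ p * struveT ν u =
      ((R : ℂ) ^ (p + 1) * struveT (ν + 1) R +
        (2 * ν + 2 - p) * ∫ u in (0 : ℝ)..R, (u : ℂ) ^ p * struveT (ν + 1) u) / 2 := by
  have hκ : -(1 / 2) < (ν + 1).re := by simp; linarith
  have hκ' : -(3 / 2) < (ν + 1).re := by linarith
  have i1 := intervalIntegrable_cpow_mul_struveT hp hν R
  have i2 := intervalIntegrable_cpow_mul_struveT hp hκ' R
  have hp' : 0 < (p + 1).re := by simp; linarith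
  have h := intervalIntegral.integral_eq_sub_of_hasDerivAt_of_le (a := 0) (b := R) hR.le
    (f := fun u : ℝ => (u : ℂ) ^ (p + 1) * struveT (ν + 1) u)
    (f' := fun u : ℝ => 2 * ((u : ℂ) ^ p * struveT ν u) -
      (2 * ν + 2 - p) * ((u : ℂ) ^ p * struveT (ν + 1) u))
    ((Complex.continuous_ofReal_cpow_const hp').mul (continuous_struveT hκ')).continuousOn
    (fun x hx => by
      have hx0 : 0 < x := hx.1
      have hx' : (x : ℂ) ≠ 0 := by exact_mod_cast hx0.ne'
      have h := (hasDerivAt_ofReal_cpow_pos hx0 (p + 1)).mul (hasDerivAt_struveT hκ hx0.ne')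
      convert! h using 1
      rw [add_sub_cancel_right, add_sub_cancel_right, ofReal_cpow_add_one hx0]
      field_simp
      ring)
    ((i1.const_mul 2).sub (i2.const_mul _))
  rw [intervalIntegral.integral_sub (i1.const_mul 2) (i2.const_mul _),
    intervalIntegral.integral_const_mul, intervalIntegral.integral_const_mul,
    Complex.ofReal_zero, Complex.zero_cpow (fun h0 => by simp [h0] at hp'), zero_mul] at h
  linear_combination h / 2

/-- The recurrence in `ν` of the value. It also holds at `ν + 1 - p/2 = 0`, where both sides are
zero, since `1/Γ` vanishes at the poles of `Γ`. -/
theorem struveMellin_succ (p ν : ℂ) :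
    (2 * ν + 2 - p) * struveMellin p (ν + 1) / 2 = struveMellin p ν := by
  have h := Complex.one_div_Gamma_eq_self_mul_one_div_Gamma_add_one (ν + 1 - p / 2)
  rw [← one_div, ← one_div] at h
  unfold struveMellin
  rw [← div_div _ _ (Complex.Gamma (ν + 1 - p / 2)), ← div_div, div_eq_mul_one_div _
    (Complex.Gamma (ν + 1 - p / 2)), h, show ν + 1 + 1 - p / 2 = ν + 1 - p / 2 + 1 by ring]
  ring

/-- The improper Mellin transform of `T_ν`, by descent on `ν` from the absolutely convergent case
`Re ν > 1/2`. -/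
theorem tendsto_integral_cpow_mul_struveT {p : ℂ} (hp : -1 < p.re) (hp1 : p.re < 1) (n : ℕ) :
    ∀ ν : ℂ, -(3 / 2) < ν.re → (p - ν).re < 3 / 2 → 1 / 2 - n < ν.re →
      Tendsto (fun R : ℝ => ∫ u in (0 : ℝ)..R, (u : ℂ) ^ p * struveT ν u) atTop
        (𝓝 (struveMellin p ν)) := by
  induction n with
  | zero =>
    intro ν _ _ hn
    obtain ⟨h1, h2⟩ := integrableOn_and_integral_struveT hp hp1 (ν := ν) (by simpa using hn)
    rw [← h2]
    exact intervalIntegral_tendsto_integral_Ioi 0 h1 tendsto_id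
  | succ n ih =>
    intro ν hν hpν hn
    have hκ : -(1 / 2) < (ν + 1).re := by simp; linarith
    have hpκ : (p - (ν + 1)).re < 1 / 2 := by simp at hpν ⊢; linarith
    have h := ih (ν + 1) (by linarith) (by linarith) (by push_cast at hn; simp; linarith)
    have hb := tendsto_cpow_mul_struveT hp1 hκ hpκ
    have h3 := (hb.add (h.const_mul (2 * ν + 2 - p))).div_const 2
    rw [zero_add, struveMellin_succ] at h3
    refine h3.congr' ?_
    filter_upwards [eventually_gt_atTop 0] with R hR
    exact (integral_cpow_mul_struveT hp hν hR).symm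

/-! ### The improper integral of the Struve function -/

theorem struveIntegrand_eq (μ ν : ℂ) {a u : ℝ} (ha : 0 < a) (hu : 0 < u) :
    struveIntegrand μ ν a u = ((a : ℂ) ^ (μ + 1 / 2) * 2 ^ (ν + 1))⁻¹ *
      (((a * u : ℝ) : ℂ) ^ (μ + ν + 3 / 2) * struveT ν (a * u)) := by
  have hau : 0 < a * u := mul_pos ha hu
  have hau' : ((a * u : ℝ) : ℂ) ≠ 0 := by exact_mod_cast hau.ne'
  have ha' : (a : ℂ) ^ (μ + 1 / 2) ≠ 0 := by
    simp [Complex.cpow_eq_zero_iff, ha.ne']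
  have h2 : (2 : ℂ) ^ (ν + 1) ≠ 0 := by simp [Complex.cpow_eq_zero_iff]
  have e1 : (((a * u : ℝ) : ℂ) / 2) ^ (ν + 1) = ((a * u : ℝ) : ℂ) ^ (ν + 1) / 2 ^ (ν + 1) := by
    have := Complex.div_cpow_ofReal_nonneg hau.le (zero_le_two) (ν + 1)
    simpa using this
  have e2 : ((a * u : ℝ) : ℂ) ^ (μ + 1 / 2) = (a : ℂ) ^ (μ + 1 / 2) * (u : ℂ) ^ (μ + 1 / 2) := by
    rw [Complex.ofReal_mul, Complex.mul_cpow_ofReal_nonneg ha.le hu.le]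
  rw [struveIntegrand, ← Complex.ofReal_mul, struveH_eq_struveT, e1,
    show μ + ν + 3 / 2 = (μ + 1 / 2) + (ν + 1) by ring,
    Complex.cpow_add (μ + 1 / 2) (ν + 1) hau', e2]
  generalize (a : ℂ) ^ (μ + 1 / 2) = X at ha' ⊢
  field_simp

/-- The integral formula with `Γ(z) tan(πz)` written as `π / (Γ(1-z) cos(πz))`, which is regular
at `z = 0`. -/
theorem hasImproperIntegral_struveIntegrand {μ ν : ℂ} {a : ℝ} (ha : 0 < a)
    (hν : -(3 / 2) < ν.re) (hlow : -(5 / 2) < (μ + ν).re) (hup : (μ + ν).re < -(1 / 2))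
    (hμ : μ.re < 0) :
    HasImproperIntegral (struveIntegrand μ ν a)
      (2 ^ (μ + 1 / 2) * (Real.pi / (Complex.Gamma (1 - (μ / 2 + ν / 2 + 3 / 4)) *
        Complex.cos (Real.pi * (μ / 2 + ν / 2 + 3 / 4)))) /
        ((a : ℂ) ^ (μ + 3 / 2) * Complex.Gamma (ν / 2 - μ / 2 + 1 / 4))) := by
  set p : ℂ := μ + ν + 3 / 2 with hp_def
  have hpre : p.re = (μ + ν).re + 3 / 2 := by rw [hp_def, Complex.add_re]; norm_num
  have hp : -1 < p.re := by linarith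
  have hp1 : p.re < 1 := by linarith
  have hpν : (p - ν).re < 3 / 2 := by
    rw [show p - ν = μ + 3 / 2 by rw [hp_def]; ring, Complex.add_re]
    norm_num
    exact hμ
  set A : ℂ := ((a : ℂ) ^ (μ + 1 / 2) * 2 ^ (ν + 1))⁻¹ with hA
  have ha' : (a : ℂ) ≠ 0 := by exact_mod_cast ha.ne'
  -- Since `ν.re > -3/2`, raising the order twice reaches the absolutely convergent range.
  have hg := tendsto_integral_cpow_mul_struveT hp hp1 2 ν hν hpν (by norm_num; linarith)
  constructor
  · intro R hR
    have h := (intervalIntegrable_cpow_mul_struveT hp hν (a * R)).comp_mul_left (c := a)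
    rw [zero_div, mul_div_cancel_left₀ _ ha.ne',
      intervalIntegrable_iff_integrableOn_Ioc_of_le hR.le] at h
    exact IntegrableOn.congr_fun (h.const_mul A)
      (fun u hu => (struveIntegrand_eq μ ν ha hu.1).symm) measurableSet_Ioc
  · have h := ((hg.comp (tendsto_id.const_mul_atTop ha)).const_mul (a : ℂ)⁻¹).const_mul A
    have hval : A * ((a : ℂ)⁻¹ * struveMellin p ν) =
        2 ^ (μ + 1 / 2) * (Real.pi / (Complex.Gamma (1 - (μ / 2 + ν / 2 + 3 / 4)) *
          Complex.cos (Real.pi * (μ / 2 + ν / 2 + 3 / 4)))) /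
          ((a : ℂ) ^ (μ + 3 / 2) * Complex.Gamma (ν / 2 - μ / 2 + 1 / 4)) := by
      have h2 : (2 : ℂ) ^ (ν + 1) ≠ 0 := by simp [Complex.cpow_eq_zero_iff]
      rw [struveMellin, hA, hp_def,
        show (μ + ν + 3 / 2) / 2 = μ / 2 + ν / 2 + 3 / 4 by ring,
        show ν + 1 - (μ / 2 + ν / 2 + 3 / 4) = ν / 2 - μ / 2 + 1 / 4 by ring,
        show μ + ν + 3 / 2 = (μ + 1 / 2) + (ν + 1) by ring,
        Complex.cpow_add (μ + 1 / 2) (ν + 1) two_ne_zero,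
        show μ + 3 / 2 = μ + 1 / 2 + 1 by ring, ofReal_cpow_add_one ha]
      generalize (2 : ℂ) ^ (ν + 1) = X at h2 ⊢
      field_simp
    rw [hval] at h
    refine h.congr' ?_
    filter_upwards [eventually_gt_atTop 0] with R hR
    have hc := intervalIntegral.integral_comp_mul_left (a := 0) (b := R)
      (fun u : ℝ => (u : ℂ) ^ p * struveT ν u) ha.ne'
    rw [mul_zero, Complex.real_smul, Complex.ofReal_inv] at hc
    simp only [Function.comp_apply, id_eq]
    rw [← hc, ← intervalIntegral.integral_const_mul, intervalIntegral.integral_of_le hR.le,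
      intervalIntegral.integral_of_le hR.le]
    exact setIntegral_congr_fun measurableSet_Ioc
      fun u hu => (struveIntegrand_eq μ ν ha hu.1).symm

/-- The reflection formula; `z = 0` is excluded because `Γ` has a pole there. -/
theorem gamma_mul_tan_pi_mul {z : ℂ} (hz : z ≠ 0) (h1 : -1 < z.re) (h2 : z.re < 1) :
    Complex.Gamma z * Complex.tan (Real.pi * z) =
      Real.pi / (Complex.Gamma (1 - z) * Complex.cos (Real.pi * z)) := by
  have hG : Complex.Gamma (1 - z) ≠ 0 :=
    Complex.Gamma_ne_zero_of_re_pos (by simpa using h2)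
  have hs : Complex.sin (Real.pi * z) ≠ 0 := by
    intro h
    obtain ⟨k, hk⟩ := Complex.sin_eq_zero_iff.1 h
    have hπ : (Real.pi : ℂ) ≠ 0 := by exact_mod_cast Real.pi_ne_zero
    have hzk : z = k := mul_left_cancel₀ hπ (hk.trans (mul_comm _ _))
    rw [hzk, Complex.intCast_re] at h1 h2
    have k1 : -1 < k := by exact_mod_cast h1
    have k2 : k < 1 := by exact_mod_cast h2
    exact hz (by rw [hzk, show k = 0 by omega, Int.cast_zero])
  rw [eq_div_of_mul_eq hG (Complex.Gamma_mul_Gamma_one_sub z), Complex.tan_eq_sin_div_cos]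
  field_simp

theorem mainTheorem11 (μ ν : ℂ) (a : ℝ) (ha : 0 < a)
    (hν : -(3 / 2) < ν.re) (hlow : -(5 / 2) < (μ + ν).re) (hup : (μ + ν).re < -(1 / 2))
    (hμ : μ.re < 0) :
    (μ + ν ≠ -(3 / 2) →
      HasImproperIntegral (struveIntegrand μ ν a)
        (2 ^ (μ + 1 / 2) * Complex.Gamma (μ / 2 + ν / 2 + 3 / 4) /
            ((a : ℂ) ^ (μ + 3 / 2) * Complex.Gamma (ν / 2 - μ / 2 + 1 / 4)) *
          Complex.tan (Real.pi * (μ / 2 + ν / 2 + 3 / 4)))) ∧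
    (μ + ν = -(3 / 2) →
      HasImproperIntegral (struveIntegrand μ ν a)
        (2 ^ (μ + 1 / 2) * Real.pi /
          ((a : ℂ) ^ (μ + 3 / 2) * Complex.Gamma (ν / 2 - μ / 2 + 1 / 4)))) := by
  have h := hasImproperIntegral_struveIntegrand ha hν hlow hup hμ
  set z : ℂ := μ / 2 + ν / 2 + 3 / 4 with hz
  have hzμ : z = (μ + ν + 3 / 2) / 2 := by rw [hz]; ring
  constructor
  · intro hne
    have hz0 : z ≠ 0 := by
      intro h0
      apply hne
      linear_combination 2 * (hzμ.symm.trans h0)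
    have hzre : z.re = ((μ + ν).re + 3 / 2) / 2 := by
      rw [hzμ]
      simp
    rw [← gamma_mul_tan_pi_mul hz0 (by linarith) (by linarith)] at h
    convert h using 1
    ring
  · intro heq
    have hz0 : z = 0 := by rw [hzμ, heq]; ring
    simpa [hz0] using h
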